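/- All graphs are finite, simple and connected. The distance $d(e,f)$ between two edges $e,f$ of a graph $G$ is their distance as vertices of the line graph $L(G)$. For $j\ge 0$ let $d_e(G,j)$ be the number of unordered pairs $\{e,f\}$ of edges of $G$ ($e=f$ allowed) with $d(e,f)=j$. The edge-Hosoya polynomial, the edge-Wiener index and the edge-hyper-Wiener index of $G$ are $$H_e(G,x)=\sum_{j\ge 0} d_e(G,j)\,x^j,\qquad W_e(G)=\sum_{\{e,f\}\subseteq E(G)} d(e,f),$$ $$WW_e(G)=\frac12\sum_{\{e,f\}\subseteq E(G)} d(e,f)+\frac12\sum_{\{e,f\}\subseteq E(G)} d(e,f)^2 .$$ For $d\ge 3$, the regular dendrimers $T_{k,d}$ ($k\ge 0$) are the trees defined as follows: $T_{0,d}$ is the one-vertex graph, $T_{1,d}$ is the star with $d+1$ vertices, and for $k\ge 2$ the tree $T_{k,d}$ is obtained from $T_{k-1,d}$ by attaching $d-1$ new vertices of degree one to each vertex of degree one. **Theorem.** For all integers $k\ge 0$ and $d\ge 3$, $$H_e(T_{k,d},x)=\sum_{i=0}^{k-1}(d-1)^{2i}\,d\,\frac{(d-1)^{k-i}-1}{d-2}\,x^{2i}+\sum_{i=0}^{k-1}(d-1)^{2i}\binom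 d2\left(d\,\frac{(d-1)^{k-i-1}-1}{d-2}+1\right)x^{2i+1},$$ $$W_e(T_{k,d})=\frac{d\left(2-2d+(d-1)^k(d^2+4d-4)+(d-1)^{2k}\bigl(2-d(d+2)+2(d-2)dk\bigr)\right)}{2(d-2)^3},$$ $$WW_e(T_{k,d})=d\,\frac{2(d-1)+(d-1)^k(4-5d^2)}{2(d-2)^4}+d\,\frac{(d-1)^{2k}\Bigl(-2-8k+d\bigl(-2+5d+16k-d(d+4)k+2(d-2)^2k^2\bigr)\Bigr)}{2(d-2)^4}.$$ -/

import Mathlib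

open Polynomial

/-- The distance between two edges of `G`: their distance in the line graph of `G`. -/
noncomputable def edgeDist {V : Type*} (G : SimpleGraph V) (e f : G.edgeSet) : ℕ :=
  G.lineGraph.dist e f

/-- The distance between the two members of an unordered pair of edges
(the two members may coincide, and then the distance is `0`). -/
noncomputable def edgePairDist {V : Type*} (G : SimpleGraph V) : Sym2 G.edgeSet → ℕ :=
  Sym2.lift ⟨edgeDist G, fun _ _ => SimpleGraph.dist_comm⟩

/-- `d_e(G, j)`: the number of unordered pairs of edges of `G` at distance `j`. -/
noncomputable def edgePairCount {V : Type*} (G : SimpleGraph V) (j : ℕ) : ℕ :=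
  Nat.card {p : Sym2 G.edgeSet // edgePairDist G p = j}

/-- The edge-Hosoya polynomial `H_e(G, x) = ∑_{j ≥ 0} d_e(G, j) x^j` (of a finite graph `G`). -/
noncomputable def edgeHosoya {V : Type*} (G : SimpleGraph V) : ℚ[X] :=
  ∑ᶠ j : ℕ, C (edgePairCount G j : ℚ) * X ^ j

/-- The edge-Wiener index (of a finite graph `G`): the sum of `d(e, f)` over all unordered
pairs of edges. -/
noncomputable def edgeWiener {V : Type*} (G : SimpleGraph V) : ℚ :=
  ∑ᶠ p : Sym2 G.edgeSet, (edgePairDist G p : ℚ)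

/-- The edge-hyper-Wiener index (of a finite graph `G`). -/
noncomputable def edgeHyperWiener {V : Type*} (G : SimpleGraph V) : ℚ :=
  1 / 2 * ∑ᶠ p : Sym2 G.edgeSet, (edgePairDist G p : ℚ)
    + 1 / 2 * ∑ᶠ p : Sym2 G.edgeSet, (edgePairDist G p : ℚ) ^ 2

/-- The vertices of degree one of `G`. -/
abbrev DegreeOneVertex {V : Type*} (G : SimpleGraph V) : Type _ :=
  {v : V // (G.neighborSet v).ncard = 1}

/-- The graph obtained from `G` by attaching `m` new vertices of degree one to each
vertex of degree one of `G`; `Sum.inr (w, i)` is the `i`-th new vertex attached to `w`. -/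
def attachPendants {V : Type*} (G : SimpleGraph V) (m : ℕ) :
    SimpleGraph (V ⊕ (DegreeOneVertex G × Fin m)) where
  Adj
    | Sum.inl u, Sum.inl v => G.Adj u v
    | Sum.inl u, Sum.inr (w, _) => u = w
    | Sum.inr (w, _), Sum.inl v => v = w
    | Sum.inr _, Sum.inr _ => False
  symm := ⟨by
    rintro (u | ⟨w, i⟩) (v | ⟨w', j⟩) h
    · exact SimpleGraph.Adj.symm (G := G) h
    · exact h
    · exact h
    · exact h⟩
  loopless := ⟨by
    rintro (u | ⟨w, i⟩) h
    · exact G.irrefl h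
    · exact h⟩

/-- The regular dendrimer `T_{k,d}`, together with its type of vertices: `T_{0,d}` is the one-vertex
graph, `T_{1,d}` is the star with `d + 1` vertices, and for `k ≥ 2` the graph `T_{k,d}` is obtained
by attaching `d - 1` new vertices of degree one to each vertex of degree one of `T_{k-1,d}`. -/
def regularDendrimerAux (d : ℕ) : ℕ → (V : Type) × SimpleGraph V
  | 0 => ⟨Unit, ⊥⟩
  | 1 => ⟨Fin (d + 1), SimpleGraph.starGraph 0⟩
  | k + 2 => ⟨_, attachPendants (regularDendrimerAux d (k + 1)).2 (d - 1)⟩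

/-- The regular dendrimer `T_{k,d}` as a graph (meaningful for `d ≥ 3`). -/
def regularDendrimer (k d : ℕ) : SimpleGraph (regularDendrimerAux d k).1 :=
  (regularDendrimerAux d k).2

/-!
The idea is to compute `∑ g (d(e, f))` over all unordered pairs of edges of `T_{k,d}` for an
arbitrary weight `g : ℕ → ℚ` (`finsum_edgePairDist_regularDendrimer`). The indicator functions of
single distances then give the coefficients of the edge-Hosoya polynomial, and `g j = j` and
`g j = j ^ 2` give the two indices.

The weight sum is computed level by level. When `m` pendant vertices are attached to each vertex
`w` of degree one, the distance between two old edges does not change, a new edge at `w` is one step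
further from each old edge than the old pendant edge at `w` is, and two new edges at different
vertices are two steps further apart than the old pendant edges there (`edgeDist_attachPendants`).
Hence the weight sums over the pairs (pendant, pendant), (pendant, arbitrary) and (arbitrary,
arbitrary) satisfy a closed recursion in which the weight is shifted by two, one and zero places
(`pendantPendantSum_attachPendants`, `pendantEdgeSum_attachPendants`,
`edgeEdgeSum_attachPendants`). Keeping `g` arbitrary is what makes the recursion solvable by
induction. For `T_{k,d}`, starting from the star, its solutions are
`pendantPendantSum_regularDendrimer` and `pendantEdgeSum_regularDendrimer`, and the increment of the
third sum agrees with the increment of the claimed formula (`hosoyaSum_succ`).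

The closed forms of the two indices follow from the same increment and the values of
`∑ q ^ i`, `∑ i * q ^ i` and `∑ i ^ 2 * q ^ i` at `q = d - 1`.
-/

/-! ### Sums over unordered pairs and distances in graphs -/

theorem Sym2.two_mul_sum_eq {α R : Type*} [Fintype α] [Fintype (Sym2 α)] [CommSemiring R]
    (F : Sym2 α → R) :
    2 * ∑ p, F p = ∑ a, ∑ b, F s(a, b) + ∑ a, F s(a, a) := by
  classical
  rw [← Fintype.sum_prod_type' (f := fun a b => F s(a, b)),
    ← Finset.sum_fiberwise (s := Finset.univ) (g := fun x : α × α => s(x.1, x.2)),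
    ← Finset.sum_fiberwise (s := Finset.univ) (g := fun a : α => s(a, a)),
    ← Finset.sum_add_distrib, Finset.mul_sum]
  refine Finset.sum_congr rfl fun p _ => ?_
  induction p using Sym2.ind with | _ a b
  by_cases hab : a = b
  · subst hab
    have h1 : Finset.univ.filter (fun x : α × α => s(x.1, x.2) = s(a, a)) = {(a, a)} := by
      ext ⟨x, y⟩; simp
    have h2 : Finset.univ.filter (fun x : α => s(x, x) = s(a, a)) = {a} := by
      ext x; simp
    rw [h1, h2, Finset.sum_singleton, Finset.sum_singleton, two_mul]
  · have h1 : Finset.univ.filter (fun x : α × α => s(x.1, x.2) = s(a, b)) =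
        {(a, b), (b, a)} := by
      ext ⟨x, y⟩; simp
    have h2 : Finset.univ.filter (fun x : α => s(x, x) = s(a, b)) = ∅ := by
      ext x; simp; grind
    rw [h1, h2, Finset.sum_empty, Finset.sum_pair (by simp [hab]), Sym2.eq_swap (a := b), two_mul,
      add_zero]

namespace SimpleGraph

/-- A function that grows by at most `1` along each edge is a lower bound for the distance from a
zero of it; walks of matching lengths make it the distance. -/
theorem dist_eq_of_forall_adj_le {V : Type*} {G : SimpleGraph V} {x : V} (δ : V → ℕ)
    (hx : δ x = 0) (hadj : ∀ y z, G.Adj y z → δ z ≤ δ y + 1)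
    (hwalk : ∀ y, ∃ p : G.Walk x y, p.length = δ y) (y : V) : G.dist x y = δ y := by
  obtain ⟨p, hp⟩ := hwalk y
  refine le_antisymm (hp ▸ dist_le p) ?_
  obtain ⟨q, hq⟩ := p.reachable.exists_walk_length_eq_dist
  rw [← hq]
  have key : ∀ {u v : V} (q : G.Walk u v), δ v ≤ δ u + q.length := by
    intro u v q
    induction q with
    | nil => simp
    | cons h q ih =>
      have := hadj _ _ h
      rw [Walk.length_cons]
      omega
  simpa [hx] using key q

end SimpleGraph

/-! ### Edges of `attachPendants` and their distances -/

section Pendant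
variable {V : Type*} {G : SimpleGraph V}

theorem exists_neighborSet_eq_singleton (w : DegreeOneVertex G) :
    ∃ v, G.neighborSet w = {v} := Set.ncard_eq_one.1 w.2

/-- The unique edge at a vertex of degree one. -/
noncomputable def pendantEdge (w : DegreeOneVertex G) : G.edgeSet :=
  ⟨s(w, (exists_neighborSet_eq_singleton w).choose), by
    have h := (exists_neighborSet_eq_singleton w).choose_spec
    exact (Set.ext_iff.1 h _).2 rfl⟩

theorem mem_edge_iff_eq_pendantEdge (w : DegreeOneVertex G) (e : G.edgeSet) :
    (w : V) ∈ (e : Sym2 V) ↔ e = pendantEdge w := by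
  refine ⟨fun h => ?_, fun h => h ▸ Sym2.mem_mk_left _ _⟩
  obtain ⟨e, he⟩ := e
  obtain ⟨v, rfl⟩ := h
  rw [SimpleGraph.mem_edgeSet, ← SimpleGraph.mem_neighborSet,
    (exists_neighborSet_eq_singleton w).choose_spec, Set.mem_singleton_iff] at he
  exact Subtype.ext (congrArg (fun u => s((w : V), u)) he)

/-- The edges of `attachPendants G m`: the edges of `G`, and for each new vertex the edge
that joins it to `G`. -/
def attachPendantsEdge (G : SimpleGraph V) (m : ℕ) :
    G.edgeSet ⊕ (DegreeOneVertex G × Fin m) → (attachPendants G m).edgeSet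
  | Sum.inl e => ⟨e.1.map Sum.inl, by
      obtain ⟨⟨u, v⟩, h⟩ := e
      exact h⟩
  | Sum.inr (w, i) => ⟨s(Sum.inl w, Sum.inr (w, i)), by
      rw [SimpleGraph.mem_edgeSet]
      exact (rfl : (w : V) = w)⟩

theorem attachPendantsEdge_bijective (G : SimpleGraph V) (m : ℕ) :
    Function.Bijective (attachPendantsEdge G m) := by
  constructor
  · rintro (e | ⟨w, i⟩) (f | ⟨w', j⟩) h <;> have h := congrArg Subtype.val h
    · exact congrArg _ (Subtype.ext (Sym2.map.injective Sum.inl_injective h))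
    · obtain ⟨⟨u, v⟩, he⟩ := e
      simp [attachPendantsEdge] at h
    · obtain ⟨⟨u, v⟩, hf⟩ := f
      simp [attachPendantsEdge] at h
    · simp only [attachPendantsEdge, Sym2.eq_iff, Sum.inl.injEq, Sum.inr.injEq, reduceCtorEq,
        false_and, or_false] at h
      exact congrArg _ h.2
  · rintro ⟨⟨u | ⟨w, i⟩, v | ⟨w', j⟩⟩, h⟩
    · exact ⟨Sum.inl ⟨s(u, v), h⟩, rfl⟩
    · obtain rfl : u = w' := h
      exact ⟨Sum.inr (w', j), rfl⟩
    · obtain rfl : v = w := h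
      exact ⟨Sum.inr (w, i), Subtype.ext Sym2.eq_swap⟩
    · exact h.elim

theorem lineGraph_attachPendants_adj_inl_inl (m : ℕ) (e f : G.edgeSet) :
    (attachPendants G m).lineGraph.Adj (attachPendantsEdge G m (Sum.inl e))
      (attachPendantsEdge G m (Sum.inl f)) ↔ G.lineGraph.Adj e f := by
  rw [SimpleGraph.lineGraph_adj_iff_exists, SimpleGraph.lineGraph_adj_iff_exists,
    (attachPendantsEdge_bijective G m).1.ne_iff, Sum.inl_injective.ne_iff]
  refine and_congr_right fun _ => ?_
  simp only [attachPendantsEdge, Sym2.mem_map]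
  constructor
  · rintro ⟨_, ⟨u, hu, rfl⟩, ⟨v, hv, h⟩⟩
    exact ⟨u, hu, Sum.inl_injective h ▸ hv⟩
  · rintro ⟨u, hu, hv⟩
    exact ⟨_, ⟨u, hu, rfl⟩, ⟨u, hv, rfl⟩⟩

theorem lineGraph_attachPendants_adj_inl_inr (m : ℕ) (e : G.edgeSet) (w : DegreeOneVertex G)
    (i : Fin m) :
    (attachPendants G m).lineGraph.Adj (attachPendantsEdge G m (Sum.inl e))
      (attachPendantsEdge G m (Sum.inr (w, i))) ↔ e = pendantEdge w := by
  rw [SimpleGraph.lineGraph_adj_iff_exists, (attachPendantsEdge_bijective G m).1.ne_iff,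
    ← mem_edge_iff_eq_pendantEdge]
  simp [attachPendantsEdge]

theorem lineGraph_attachPendants_adj_inr_inr (m : ℕ) (w w' : DegreeOneVertex G) (i j : Fin m) :
    (attachPendants G m).lineGraph.Adj (attachPendantsEdge G m (Sum.inr (w, i)))
      (attachPendantsEdge G m (Sum.inr (w', j))) ↔ w = w' ∧ i ≠ j := by
  rw [SimpleGraph.lineGraph_adj_iff_exists, (attachPendantsEdge_bijective G m).1.ne_iff]
  simp [attachPendantsEdge, Subtype.ext_iff]
  grind

open Classical in
/-- The distance in the line graph of `attachPendants G m` in terms of distances in the line graph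
of `G`, with edges named through `attachPendantsEdge`; that it is the distance is
`edgeDist_attachPendants`. Edges at the same vertex `w` meet in `w`, while a shortest path between
new edges at different vertices `w` and `w'` passes through the pendant edges at `w` and `w'`, even
if these coincide. -/
noncomputable def attachPendantsEdgeDist (G : SimpleGraph V) (m : ℕ) :
    G.edgeSet ⊕ (DegreeOneVertex G × Fin m) → G.edgeSet ⊕ (DegreeOneVertex G × Fin m) → ℕ
  | Sum.inl e, Sum.inl f => edgeDist G e f
  | Sum.inl e, Sum.inr (w, _) => edgeDist G e (pendantEdge w) + 1
  | Sum.inr (w, _), Sum.inl e => edgeDist G (pendantEdge w) e + 1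
  | Sum.inr (w, i), Sum.inr (w', j) =>
    if w = w' then (if i = j then 0 else 1) else edgeDist G (pendantEdge w) (pendantEdge w') + 2

theorem edgeDist_le_succ_of_adj (hG : G.lineGraph.Preconnected) (x : G.edgeSet) {e f : G.edgeSet}
    (h : G.lineGraph.Adj e f) : edgeDist G x f ≤ edgeDist G x e + 1 := by
  have := (hG x e).dist_triangle_left f
  rw [SimpleGraph.dist_eq_one_iff_adj.2 h] at this
  exact this

theorem attachPendantsEdgeDist_le_succ (hG : G.lineGraph.Preconnected) (m : ℕ)
    (x y z : G.edgeSet ⊕ (DegreeOneVertex G × Fin m))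
    (h : (attachPendants G m).lineGraph.Adj (attachPendantsEdge G m y)
      (attachPendantsEdge G m z)) :
    attachPendantsEdgeDist G m x z ≤ attachPendantsEdgeDist G m x y + 1 := by
  have hself (e : G.edgeSet) : edgeDist G e e = 0 := SimpleGraph.dist_self
  obtain e | ⟨w, i⟩ := y <;> obtain f | ⟨w', j⟩ := z
  · rw [lineGraph_attachPendants_adj_inl_inl] at h
    obtain x | ⟨v, l⟩ := x
    · exact edgeDist_le_succ_of_adj hG _ h
    · exact Nat.succ_le_succ (edgeDist_le_succ_of_adj hG _ h)
  · rw [lineGraph_attachPendants_adj_inl_inr] at h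
    subst h
    obtain x | ⟨v, l⟩ := x <;> simp only [attachPendantsEdgeDist] <;> grind
  · rw [SimpleGraph.adj_comm, lineGraph_attachPendants_adj_inl_inr] at h
    subst h
    obtain x | ⟨v, l⟩ := x <;> simp only [attachPendantsEdgeDist] <;> grind
  · rw [lineGraph_attachPendants_adj_inr_inr] at h
    obtain ⟨rfl, h⟩ := h
    obtain x | ⟨v, l⟩ := x <;> simp only [attachPendantsEdgeDist] <;> grind

theorem exists_walk_lineGraph_attachPendants (hG : G.lineGraph.Preconnected) (m : ℕ)
    (x y : G.edgeSet ⊕ (DegreeOneVertex G × Fin m)) :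
    ∃ p : (attachPendants G m).lineGraph.Walk (attachPendantsEdge G m x)
      (attachPendantsEdge G m y), p.length = attachPendantsEdgeDist G m x y := by
  let φ : G.lineGraph →g (attachPendants G m).lineGraph :=
    ⟨fun e => attachPendantsEdge G m (Sum.inl e),
      fun h => (lineGraph_attachPendants_adj_inl_inl m _ _).2 h⟩
  have old (e f : G.edgeSet) : ∃ p : (attachPendants G m).lineGraph.Walk
      (attachPendantsEdge G m (Sum.inl e)) (attachPendantsEdge G m (Sum.inl f)),
      p.length = edgeDist G e f := by
    obtain ⟨p, hp⟩ := (hG e f).exists_walk_length_eq_dist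
    exact ⟨p.map φ, (p.length_map φ).trans hp⟩
  have new (w : DegreeOneVertex G) (i : Fin m) : (attachPendants G m).lineGraph.Adj
      (attachPendantsEdge G m (Sum.inl (pendantEdge w)))
      (attachPendantsEdge G m (Sum.inr (w, i))) :=
    (lineGraph_attachPendants_adj_inl_inr m _ w i).2 rfl
  obtain e | ⟨w, i⟩ := x <;> obtain f | ⟨w', j⟩ := y
  · exact old e f
  · obtain ⟨p, hp⟩ := old e (pendantEdge w')
    exact ⟨p.concat (new w' j), by rw [SimpleGraph.Walk.length_concat, hp]; rfl⟩
  · obtain ⟨p, hp⟩ := old (pendantEdge w) f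
    exact ⟨.cons (new w i).symm p, by rw [SimpleGraph.Walk.length_cons, hp]; rfl⟩
  · by_cases hw : w = w'
    · subst hw
      by_cases hij : i = j
      · subst hij
        exact ⟨.nil, by simp [attachPendantsEdgeDist]⟩
      · exact ⟨.cons ((lineGraph_attachPendants_adj_inr_inr m w w i j).2 ⟨rfl, hij⟩) .nil,
          by simp [attachPendantsEdgeDist, hij]⟩
    · obtain ⟨p, hp⟩ := old (pendantEdge w) (pendantEdge w')
      exact ⟨.cons (new w i).symm (p.concat (new w' j)), by
        simp [attachPendantsEdgeDist, hw, hp]⟩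

theorem edgeDist_attachPendants (hG : G.lineGraph.Preconnected) (m : ℕ)
    (x y : G.edgeSet ⊕ (DegreeOneVertex G × Fin m)) :
    edgeDist (attachPendants G m) (attachPendantsEdge G m x) (attachPendantsEdge G m y) =
      attachPendantsEdgeDist G m x y := by
  let σ := Equiv.ofBijective _ (attachPendantsEdge_bijective G m)
  have key := SimpleGraph.dist_eq_of_forall_adj_le (G := (attachPendants G m).lineGraph)
    (x := σ x) (fun e => attachPendantsEdgeDist G m x (σ.symm e)) ?_ ?_ ?_ (σ y)
  · simp only [σ.symm_apply_apply] at key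
    exact key
  · rw [σ.symm_apply_apply]
    obtain e | ⟨w, i⟩ := x
    · exact SimpleGraph.dist_self
    · simp [attachPendantsEdgeDist]
  · intro e f h
    refine attachPendantsEdgeDist_le_succ hG m x _ _ ?_
    change (attachPendants G m).lineGraph.Adj (σ (σ.symm e)) (σ (σ.symm f))
    simpa using h
  · intro e
    obtain ⟨y, rfl⟩ := σ.surjective e
    rw [σ.symm_apply_apply]
    exact exists_walk_lineGraph_attachPendants hG m x y

theorem lineGraph_attachPendants_preconnected (hG : G.lineGraph.Preconnected) (m : ℕ) :
    (attachPendants G m).lineGraph.Preconnected := by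
  intro e f
  obtain ⟨x, rfl⟩ := (attachPendantsEdge_bijective G m).2 e
  obtain ⟨y, rfl⟩ := (attachPendantsEdge_bijective G m).2 f
  exact (exists_walk_lineGraph_attachPendants hG m x y).choose.reachable

theorem neighborSet_attachPendants_inr (m : ℕ) (p : DegreeOneVertex G × Fin m) :
    (attachPendants G m).neighborSet (Sum.inr p) = {Sum.inl (p.1 : V)} := by
  ext (v | q)
  · simp only [SimpleGraph.mem_neighborSet, Set.mem_singleton_iff, Sum.inl.injEq]
    rfl
  · simp only [SimpleGraph.mem_neighborSet, Set.mem_singleton_iff, reduceCtorEq, iff_false]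
    exact id

theorem ncard_neighborSet_attachPendants_inl_ne_one {m : ℕ} (hm : 0 < m) (v : V) :
    ((attachPendants G m).neighborSet (Sum.inl v)).ncard ≠ 1 := by
  intro h
  by_cases hv : (G.neighborSet v).ncard = 1
  · obtain ⟨u, hu⟩ := Set.ncard_eq_one.1 hv
    have h1 : (Sum.inl u) ∈ (attachPendants G m).neighborSet (Sum.inl v) :=
      show u ∈ G.neighborSet v by rw [hu]; rfl
    have h2 : (Sum.inr (⟨v, hv⟩, ⟨0, hm⟩)) ∈ (attachPendants G m).neighborSet (Sum.inl v) :=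
      (rfl : v = v)
    obtain ⟨a, ha⟩ := Set.ncard_eq_one.1 h
    rw [ha, Set.mem_singleton_iff] at h1 h2
    exact Sum.inl_ne_inr (h1.trans h2.symm)
  · apply hv
    rw [← h, ← Set.ncard_image_of_injective (G.neighborSet v) (Sum.inl_injective
      (β := DegreeOneVertex G × Fin m))]
    congr 1
    ext (u | ⟨w, i⟩)
    · simp only [Set.mem_image, Sum.inl.injEq, exists_eq_right]
      rfl
    · simp only [Set.mem_image, reduceCtorEq, and_false, exists_false, false_iff]
      intro hw
      obtain rfl : v = w := hw
      exact hv w.2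

/-- The vertices of degree one of `attachPendants G m` are the new vertices. -/
noncomputable def degreeOneVertexAttachPendantsEquiv (G : SimpleGraph V) {m : ℕ} (hm : 0 < m) :
    DegreeOneVertex G × Fin m ≃ DegreeOneVertex (attachPendants G m) :=
  Equiv.ofBijective
    (fun p => ⟨Sum.inr p, by rw [neighborSet_attachPendants_inr, Set.ncard_singleton]⟩) <| by
    constructor
    · intro p q h
      exact Sum.inr_injective (congrArg Subtype.val h)
    · rintro ⟨v | p, h⟩
      · exact (ncard_neighborSet_attachPendants_inl_ne_one hm v h).elim
      · exact ⟨p, rfl⟩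

theorem pendantEdge_attachPendants {m : ℕ} (hm : 0 < m) (p : DegreeOneVertex G × Fin m) :
    pendantEdge (degreeOneVertexAttachPendantsEquiv G hm p) =
      attachPendantsEdge G m (Sum.inr p) := by
  symm
  rw [← mem_edge_iff_eq_pendantEdge]
  exact Sym2.mem_mk_right _ _

end Pendant

/-! ### Distance sums under `attachPendants` -/

section Sums
variable {V : Type*}

/-- The sum of `g (d(e, f))` over all ordered pairs of edges. -/
noncomputable def edgeEdgeSum (G : SimpleGraph V) (g : ℕ → ℚ) : ℚ :=
  ∑ᶠ (e : G.edgeSet) (f : G.edgeSet), g (edgeDist G e f)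

/-- The sum of `g (d(e, f))` over all edges `f` and all pendant edges `e`, the latter indexed by
the vertices of degree one. -/
noncomputable def pendantEdgeSum (G : SimpleGraph V) (g : ℕ → ℚ) : ℚ :=
  ∑ᶠ (w : DegreeOneVertex G) (f : G.edgeSet), g (edgeDist G (pendantEdge w) f)

/-- The sum of `g (d(e, f))` over all ordered pairs of pendant edges, indexed by the pairs of
vertices of degree one. -/
noncomputable def pendantPendantSum (G : SimpleGraph V) (g : ℕ → ℚ) : ℚ :=
  ∑ᶠ (w : DegreeOneVertex G) (w' : DegreeOneVertex G),
    g (edgeDist G (pendantEdge w) (pendantEdge w'))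

variable {G : SimpleGraph V}

theorem two_mul_finsum_edgePairDist [Finite V] (g : ℕ → ℚ) :
    2 * ∑ᶠ p : Sym2 G.edgeSet, g (edgePairDist G p) =
      edgeEdgeSum G g + Nat.card G.edgeSet * g 0 := by
  classical
  have := Fintype.ofFinite G.edgeSet
  simp only [edgeEdgeSum, finsum_eq_sum_of_fintype]
  rw [Sym2.two_mul_sum_eq (fun p => g (edgePairDist G p))]
  congr 1
  have (e : G.edgeSet) : edgePairDist G s(e, e) = 0 := SimpleGraph.dist_self
  simp [this]

theorem card_edgeSet_attachPendants [Finite V] (m : ℕ) :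
    Nat.card (attachPendants G m).edgeSet =
      Nat.card G.edgeSet + Nat.card (DegreeOneVertex G) * m := by
  rw [← Nat.card_congr (Equiv.ofBijective _ (attachPendantsEdge_bijective G m)), Nat.card_sum,
    Nat.card_prod, Nat.card_fin]

theorem card_degreeOneVertex_attachPendants {m : ℕ} (hm : 0 < m) :
    Nat.card (DegreeOneVertex (attachPendants G m)) = Nat.card (DegreeOneVertex G) * m := by
  rw [← Nat.card_congr (degreeOneVertexAttachPendantsEquiv G hm), Nat.card_prod, Nat.card_fin]

open Classical in
/-- New edges at different vertices are two steps further apart than the old pendant edges there;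
the `m ^ 2` ordered pairs of new edges at one vertex have distance `0` or `1`. -/
theorem sum_sum_attachPendantsEdgeDist [Fintype (DegreeOneVertex G)] (m : ℕ) (g : ℕ → ℚ) :
    ∑ p : DegreeOneVertex G × Fin m, ∑ q : DegreeOneVertex G × Fin m,
        g (attachPendantsEdgeDist G m (Sum.inr p) (Sum.inr q)) =
      (m : ℚ) ^ 2 * (∑ w : DegreeOneVertex G, ∑ w' : DegreeOneVertex G,
          g (edgeDist G (pendantEdge w) (pendantEdge w') + 2) -
          Nat.card (DegreeOneVertex G) * g 2) +
        Nat.card (DegreeOneVertex G) * (m * g 0 + m * (m - 1) * g 1) := by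
  have hself (e : G.edgeSet) : edgeDist G e e = 0 := SimpleGraph.dist_self
  have same (w : DegreeOneVertex G) : ∑ i : Fin m, ∑ j : Fin m,
      g (attachPendantsEdgeDist G m (Sum.inr (w, i)) (Sum.inr (w, j))) =
        m * g 0 + m * (m - 1) * g 1 := by
    have (i j : Fin m) : g (attachPendantsEdgeDist G m (Sum.inr (w, i)) (Sum.inr (w, j))) =
        g 1 + if i = j then g 0 - g 1 else 0 := by
      by_cases h : i = j <;> simp [attachPendantsEdgeDist, h]
    simp only [this, Finset.sum_add_distrib, Finset.sum_ite_eq, Finset.mem_univ, if_true,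
      Finset.sum_const, Finset.card_univ, Fintype.card_fin, nsmul_eq_mul]
    ring
  have pair (w w' : DegreeOneVertex G) : ∑ i : Fin m, ∑ j : Fin m,
      g (attachPendantsEdgeDist G m (Sum.inr (w, i)) (Sum.inr (w', j))) =
        (m : ℚ) ^ 2 * g (edgeDist G (pendantEdge w) (pendantEdge w') + 2) +
          if w = w' then m * g 0 + m * (m - 1) * g 1 - (m : ℚ) ^ 2 * g 2 else 0 := by
    by_cases h : w = w'
    · subst h
      rw [same, hself, if_pos rfl]
      ring
    · simp only [attachPendantsEdgeDist, h, if_false, Finset.sum_const, Finset.card_univ,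
        Fintype.card_fin, nsmul_eq_mul]
      ring
  rw [Fintype.sum_prod_type]
  simp only [Fintype.sum_prod_type]
  have comm (w : DegreeOneVertex G) : ∑ i : Fin m, ∑ w' : DegreeOneVertex G, ∑ j : Fin m,
      g (attachPendantsEdgeDist G m (Sum.inr (w, i)) (Sum.inr (w', j))) =
      ∑ w' : DegreeOneVertex G, ∑ i : Fin m, ∑ j : Fin m,
      g (attachPendantsEdgeDist G m (Sum.inr (w, i)) (Sum.inr (w', j))) := Finset.sum_comm
  simp only [comm, pair, Finset.sum_add_distrib, Finset.sum_ite_eq, Finset.mem_univ, if_true,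
    Finset.sum_const, Finset.card_univ, nsmul_eq_mul, ← Finset.mul_sum, Nat.card_eq_fintype_card]
  ring

theorem pendantPendantSum_attachPendants [Finite V] (hG : G.lineGraph.Preconnected)
    {m : ℕ} (hm : 0 < m) (g : ℕ → ℚ) :
    pendantPendantSum (attachPendants G m) g =
      (m : ℚ) ^ 2 * (pendantPendantSum G (fun j => g (j + 2)) -
          Nat.card (DegreeOneVertex G) * g 2) +
        Nat.card (DegreeOneVertex G) * (m * g 0 + m * (m - 1) * g 1) := by
  classical
  have := Fintype.ofFinite (DegreeOneVertex G)
  have := Fintype.ofFinite (DegreeOneVertex (attachPendants G m))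
  simp only [pendantPendantSum, finsum_eq_sum_of_fintype]
  rw [← sum_sum_attachPendantsEdgeDist]
  simp only [← (degreeOneVertexAttachPendantsEquiv G hm).sum_comp, pendantEdge_attachPendants,
    edgeDist_attachPendants hG]

theorem pendantEdgeSum_attachPendants [Finite V] (hG : G.lineGraph.Preconnected)
    {m : ℕ} (hm : 0 < m) (g : ℕ → ℚ) :
    pendantEdgeSum (attachPendants G m) g =
      m * pendantEdgeSum G (fun j => g (j + 1)) + pendantPendantSum (attachPendants G m) g := by
  classical
  have := Fintype.ofFinite (DegreeOneVertex G)
  have := Fintype.ofFinite G.edgeSet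
  have := Fintype.ofFinite (attachPendants G m).edgeSet
  have := Fintype.ofFinite (DegreeOneVertex (attachPendants G m))
  simp only [pendantEdgeSum, pendantPendantSum, finsum_eq_sum_of_fintype]
  simp only [← (degreeOneVertexAttachPendantsEquiv G hm).sum_comp, pendantEdge_attachPendants,
    ← (attachPendantsEdge_bijective G m).sum_comp, Fintype.sum_sum_type,
    edgeDist_attachPendants hG, Finset.sum_add_distrib]
  congr 1
  simp only [Fintype.sum_prod_type, attachPendantsEdgeDist, Finset.sum_const, Finset.card_univ,
    Fintype.card_fin, nsmul_eq_mul, Finset.mul_sum]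

theorem edgeEdgeSum_attachPendants [Finite V] (hG : G.lineGraph.Preconnected) {m : ℕ} (hm : 0 < m)
    (g : ℕ → ℚ) :
    edgeEdgeSum (attachPendants G m) g =
      edgeEdgeSum G g + 2 * pendantEdgeSum (attachPendants G m) g -
        pendantPendantSum (attachPendants G m) g := by
  classical
  have := Fintype.ofFinite (DegreeOneVertex G)
  have := Fintype.ofFinite G.edgeSet
  have := Fintype.ofFinite (attachPendants G m).edgeSet
  have := Fintype.ofFinite (DegreeOneVertex (attachPendants G m))
  simp only [pendantEdgeSum, pendantPendantSum, edgeEdgeSum, finsum_eq_sum_of_fintype]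
  simp only [← (degreeOneVertexAttachPendantsEquiv G hm).sum_comp, pendantEdge_attachPendants,
    ← (attachPendantsEdge_bijective G m).sum_comp, Fintype.sum_sum_type,
    edgeDist_attachPendants hG, Finset.sum_add_distrib]
  have symm : ∑ e : G.edgeSet, ∑ p : DegreeOneVertex G × Fin m,
      g (attachPendantsEdgeDist G m (Sum.inl e) (Sum.inr p)) =
      ∑ p : DegreeOneVertex G × Fin m, ∑ e : G.edgeSet,
        g (attachPendantsEdgeDist G m (Sum.inr p) (Sum.inl e)) := by
    rw [Finset.sum_comm]
    refine Finset.sum_congr rfl fun p _ => Finset.sum_congr rfl fun e _ => ?_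
    rw [← edgeDist_attachPendants hG, ← edgeDist_attachPendants hG]
    exact congrArg g SimpleGraph.dist_comm
  rw [symm]
  simp only [attachPendantsEdgeDist]
  ring

/-- Summing `X ^ d(e, f)` over the unordered pairs of edges gives the edge-Hosoya polynomial. -/
theorem edgeHosoya_eq_sum [Fintype (Sym2 G.edgeSet)] :
    edgeHosoya G = ∑ p : Sym2 G.edgeSet, (X : ℚ[X]) ^ edgePairDist G p := by
  classical
  have hcount (j : ℕ) : edgePairCount G j =
      (Finset.univ.filter fun p => edgePairDist G p = j).card := by
    rw [edgePairCount, Nat.card_eq_fintype_card, Fintype.card_subtype]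
  rw [edgeHosoya, Finset.sum_comp (fun j => (X : ℚ[X]) ^ j) (edgePairDist G),
    finsum_eq_sum_of_support_subset (s := Finset.univ.image (edgePairDist G))]
  · refine Finset.sum_congr rfl fun j _ => ?_
    rw [hcount, nsmul_eq_mul, map_natCast]
  · intro j hj
    by_contra h
    apply hj
    have : (Finset.univ.filter fun p => edgePairDist G p = j) = ∅ := by
      ext p
      simp at h ⊢
      exact h p
    simp [hcount, this]

theorem coeff_edgeHosoya [Finite V] (n : ℕ) :
    (edgeHosoya G).coeff n = ∑ᶠ p : Sym2 G.edgeSet, if n = edgePairDist G p then 1 else 0 := by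
  classical
  have := Fintype.ofFinite (Sym2 G.edgeSet)
  simp only [edgeHosoya_eq_sum, finsetSum_coeff, coeff_X_pow, finsum_eq_sum_of_fintype]

end Sums

/-! ### Stars -/

section Star
variable {d : ℕ}

/-- The edges of the star with centre `0`. -/
def starGraphEdge (d : ℕ) (i : Fin d) : (SimpleGraph.starGraph (0 : Fin (d + 1))).edgeSet :=
  ⟨s(0, i.succ), SimpleGraph.starGraph_center_adj (Fin.succ_ne_zero i).symm⟩

theorem starGraphEdge_bijective (d : ℕ) : Function.Bijective (starGraphEdge d) := by
  constructor
  · intro i j h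
    have h := congrArg Subtype.val h
    simpa [starGraphEdge] using h
  · rintro ⟨⟨u, v⟩, h⟩
    have h' := h
    change (SimpleGraph.starGraph (0 : Fin (d + 1))).Adj u v at h'
    rw [SimpleGraph.starGraph_adj] at h'
    obtain ⟨hne, rfl | rfl⟩ := h'
    · obtain ⟨i, rfl⟩ := Fin.exists_succ_eq.2 hne.symm
      exact ⟨i, rfl⟩
    · obtain ⟨i, rfl⟩ := Fin.exists_succ_eq.2 hne
      exact ⟨i, Subtype.ext Sym2.eq_swap⟩

theorem lineGraph_starGraph_adj {i j : Fin d} (h : i ≠ j) :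
    (SimpleGraph.starGraph (0 : Fin (d + 1))).lineGraph.Adj (starGraphEdge d i)
      (starGraphEdge d j) := by
  rw [SimpleGraph.lineGraph_adj_iff_exists]
  exact ⟨(starGraphEdge_bijective d).1.ne h, 0, Sym2.mem_mk_left _ _, Sym2.mem_mk_left _ _⟩

theorem edgeDist_starGraph (i j : Fin d) :
    edgeDist (SimpleGraph.starGraph (0 : Fin (d + 1))) (starGraphEdge d i) (starGraphEdge d j) =
      if i = j then 0 else 1 := by
  by_cases h : i = j
  · subst h
    rw [if_pos rfl]
    exact SimpleGraph.dist_self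
  · rw [if_neg h]
    exact SimpleGraph.dist_eq_one_iff_adj.2 (lineGraph_starGraph_adj h)

theorem lineGraph_starGraph_preconnected (d : ℕ) :
    (SimpleGraph.starGraph (0 : Fin (d + 1))).lineGraph.Preconnected := by
  intro e f
  obtain ⟨i, rfl⟩ := (starGraphEdge_bijective d).2 e
  obtain ⟨j, rfl⟩ := (starGraphEdge_bijective d).2 f
  by_cases h : i = j
  · rw [h]
  · exact (lineGraph_starGraph_adj h).reachable

theorem neighborSet_starGraph_succ (i : Fin d) :
    (SimpleGraph.starGraph (0 : Fin (d + 1))).neighborSet i.succ = {0} := by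
  ext v
  simp only [SimpleGraph.mem_neighborSet, SimpleGraph.starGraph_adj, Set.mem_singleton_iff]
  refine ⟨fun h => h.2.resolve_left (Fin.succ_ne_zero i), ?_⟩
  rintro rfl
  exact ⟨Fin.succ_ne_zero i, .inr rfl⟩

theorem ncard_neighborSet_starGraph_zero (d : ℕ) :
    ((SimpleGraph.starGraph (0 : Fin (d + 1))).neighborSet 0).ncard = d := by
  have : (SimpleGraph.starGraph (0 : Fin (d + 1))).neighborSet 0 = Set.range Fin.succ := by
    ext v
    rw [SimpleGraph.mem_neighborSet, SimpleGraph.starGraph_adj_center_iff, ne_comm,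
      ← Fin.exists_succ_eq, Set.mem_range]
  rw [this, ← Set.image_univ, Set.ncard_image_of_injective _ (Fin.succ_injective d),
    Set.ncard_univ, Nat.card_fin]

/-- The vertices of degree one of a star with at least two leaves are its leaves. -/
noncomputable def degreeOneVertexStarGraphEquiv (hd : 2 ≤ d) :
    Fin d ≃ DegreeOneVertex (SimpleGraph.starGraph (0 : Fin (d + 1))) :=
  Equiv.ofBijective
    (fun i => ⟨i.succ, by rw [neighborSet_starGraph_succ, Set.ncard_singleton]⟩) <| by
    constructor
    · intro i j h
      exact Fin.succ_injective d (congrArg Subtype.val h)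
    · rintro ⟨v, hv⟩
      have hne : v ≠ 0 := by
        rintro rfl
        rw [ncard_neighborSet_starGraph_zero] at hv
        omega
      obtain ⟨i, rfl⟩ := Fin.exists_succ_eq.2 hne
      exact ⟨i, rfl⟩

theorem pendantEdge_starGraph (hd : 2 ≤ d) (i : Fin d) :
    pendantEdge (degreeOneVertexStarGraphEquiv hd i) = starGraphEdge d i := by
  symm
  rw [← mem_edge_iff_eq_pendantEdge]
  exact Sym2.mem_mk_right _ _

theorem sum_sum_edgeDist_starGraph (d : ℕ) (g : ℕ → ℚ) :
    ∑ i : Fin d, ∑ j : Fin d,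
      g (edgeDist (SimpleGraph.starGraph 0) (starGraphEdge d i) (starGraphEdge d j)) =
      d * g 0 + d * (d - 1) * g 1 := by
  have (i j : Fin d) :
      g (edgeDist (SimpleGraph.starGraph 0) (starGraphEdge d i) (starGraphEdge d j)) =
        g 1 + if i = j then g 0 - g 1 else 0 := by
    rw [edgeDist_starGraph]
    by_cases h : i = j <;> simp [h]
  simp only [this, Finset.sum_add_distrib, Finset.sum_ite_eq, Finset.mem_univ, if_true,
    Finset.sum_const, Finset.card_univ, Fintype.card_fin, nsmul_eq_mul]
  ring

theorem edgeEdgeSum_starGraph (g : ℕ → ℚ) :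
    edgeEdgeSum (SimpleGraph.starGraph (0 : Fin (d + 1))) g =
      d * g 0 + d * (d - 1) * g 1 := by
  have := Fintype.ofFinite (SimpleGraph.starGraph (0 : Fin (d + 1))).edgeSet
  simp only [edgeEdgeSum, finsum_eq_sum_of_fintype]
  simp only [← (starGraphEdge_bijective d).sum_comp, sum_sum_edgeDist_starGraph]

theorem pendantEdgeSum_starGraph (hd : 2 ≤ d) (g : ℕ → ℚ) :
    pendantEdgeSum (SimpleGraph.starGraph (0 : Fin (d + 1))) g =
      d * g 0 + d * (d - 1) * g 1 := by
  have := Fintype.ofFinite (SimpleGraph.starGraph (0 : Fin (d + 1))).edgeSet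
  have := Fintype.ofFinite (DegreeOneVertex (SimpleGraph.starGraph (0 : Fin (d + 1))))
  simp only [pendantEdgeSum, finsum_eq_sum_of_fintype]
  simp only [← (degreeOneVertexStarGraphEquiv hd).sum_comp, pendantEdge_starGraph,
    ← (starGraphEdge_bijective d).sum_comp, sum_sum_edgeDist_starGraph]

theorem pendantPendantSum_starGraph (hd : 2 ≤ d) (g : ℕ → ℚ) :
    pendantPendantSum (SimpleGraph.starGraph (0 : Fin (d + 1))) g =
      d * g 0 + d * (d - 1) * g 1 := by
  have := Fintype.ofFinite (DegreeOneVertex (SimpleGraph.starGraph (0 : Fin (d + 1))))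
  simp only [pendantPendantSum, finsum_eq_sum_of_fintype]
  simp only [← (degreeOneVertexStarGraphEquiv hd).sum_comp, pendantEdge_starGraph,
    sum_sum_edgeDist_starGraph]

end Star

/-! ### The regular dendrimers -/

section Dendrimer

theorem finite_regularDendrimerAux (d : ℕ) : ∀ k, Finite (regularDendrimerAux d k).1
  | 0 => inferInstanceAs (Finite Unit)
  | 1 => inferInstanceAs (Finite (Fin (d + 1)))
  | k + 2 =>
    have := finite_regularDendrimerAux d (k + 1)
    inferInstanceAs (Finite ((regularDendrimerAux d (k + 1)).1 ⊕
      (DegreeOneVertex (regularDendrimer (k + 1) d) × Fin (d - 1))))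

theorem lineGraph_regularDendrimer_preconnected (d k : ℕ) :
    (regularDendrimer (k + 1) d).lineGraph.Preconnected := by
  induction k with
  | zero => exact lineGraph_starGraph_preconnected d
  | succ k ih => exact lineGraph_attachPendants_preconnected ih _

theorem card_degreeOneVertex_regularDendrimer {d : ℕ} (hd : 2 ≤ d) (k : ℕ) :
    (Nat.card (DegreeOneVertex (regularDendrimer (k + 1) d)) : ℚ) = d * ((d : ℚ) - 1) ^ k := by
  induction k with
  | zero =>
    have h : d = Nat.card (DegreeOneVertex (regularDendrimer (0 + 1) d)) :=
      (Nat.card_fin d).symm.trans (Nat.card_congr (degreeOneVertexStarGraphEquiv hd))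
    rw [← h, pow_zero, mul_one]
  | succ k ih =>
    have h := card_degreeOneVertex_attachPendants (G := regularDendrimer (k + 1) d)
      (m := d - 1) (by omega)
    change Nat.card (DegreeOneVertex (regularDendrimer (k + 2) d)) = _ at h
    rw [h, Nat.cast_mul, ih, Nat.cast_pred (by omega)]
    ring

/-- The lowest common ancestor of two distinct vertices of the outermost level lies either `i + 1`
levels above them, with `i < k`, or it is the central vertex, which has one more branch. -/
theorem pendantPendantSum_regularDendrimer {d : ℕ} (hd : 2 ≤ d) (k : ℕ) (g : ℕ → ℚ) :
    pendantPendantSum (regularDendrimer (k + 1) d) g =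
      d * ((d : ℚ) - 1) ^ k * (g 0
        + ∑ i ∈ Finset.range k, ((d : ℚ) - 2) * ((d : ℚ) - 1) ^ i * g (2 * i + 1)
        + ((d : ℚ) - 1) ^ (k + 1) * g (2 * k + 1)) := by
  induction k generalizing g with
  | zero =>
    refine (pendantPendantSum_starGraph hd g).trans ?_
    simp
    ring
  | succ k ih =>
    have := finite_regularDendrimerAux d (k + 1)
    refine (pendantPendantSum_attachPendants (lineGraph_regularDendrimer_preconnected d k)
      (by omega : 0 < d - 1) g).trans ?_
    rw [ih, card_degreeOneVertex_regularDendrimer hd, Nat.cast_pred (by omega),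
      Finset.sum_range_succ']
    have : ∑ i ∈ Finset.range k, ((d : ℚ) - 2) * ((d : ℚ) - 1) ^ (i + 1) * g (2 * (i + 1) + 1) =
        ((d : ℚ) - 1) * ∑ i ∈ Finset.range k,
          ((d : ℚ) - 2) * ((d : ℚ) - 1) ^ i * g (2 * i + 1 + 2) := by
      rw [Finset.mul_sum]
      refine Finset.sum_congr rfl fun i _ => ?_
      rw [show 2 * (i + 1) + 1 = 2 * i + 1 + 2 by ring]
      ring
    rw [this, show 2 * (k + 1) + 1 = 2 * k + 1 + 2 by ring]
    ring_nf

theorem pendantEdgeSum_regularDendrimer_add_two {d : ℕ} (hd : 2 ≤ d) (k : ℕ) (g : ℕ → ℚ) :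
    pendantEdgeSum (regularDendrimer (k + 2) d) g =
      ((d : ℚ) - 1) * pendantEdgeSum (regularDendrimer (k + 1) d) (fun j => g (j + 1))
        + pendantPendantSum (regularDendrimer (k + 2) d) g := by
  have := finite_regularDendrimerAux d (k + 1)
  rw [← Nat.cast_pred (by omega : 0 < d)]
  exact pendantEdgeSum_attachPendants (lineGraph_regularDendrimer_preconnected d k)
    (by omega : 0 < d - 1) g

/-- Every pendant edge has exactly `(d - 1) ^ i` edges at distance `2 * i` and
`(d - 1) ^ (i + 1)` edges at distance `2 * i + 1`, up to the diameter. -/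
theorem pendantEdgeSum_regularDendrimer {d : ℕ} (hd : 2 ≤ d) (k : ℕ) (g : ℕ → ℚ) :
    pendantEdgeSum (regularDendrimer (k + 1) d) g =
      d * ((d : ℚ) - 1) ^ k * ∑ i ∈ Finset.range (k + 1),
        ((d : ℚ) - 1) ^ i * (g (2 * i) + ((d : ℚ) - 1) * g (2 * i + 1)) := by
  induction k generalizing g with
  | zero =>
    refine (pendantEdgeSum_starGraph hd g).trans ?_
    simp
    ring
  | succ k ih =>
    rw [pendantEdgeSum_regularDendrimer_add_two hd, pendantPendantSum_regularDendrimer hd, ih]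
    set q : ℚ := (d : ℚ) - 1 with hq
    have hd2 : (d : ℚ) - 2 = q - 1 := by rw [hq]; ring
    -- The even distances shift by one place, the odd ones do not.
    have h1 : ∑ i ∈ Finset.range (k + 1 + 1), q ^ i * (g (2 * i) + q * g (2 * i + 1)) =
        ∑ i ∈ Finset.range (k + 1), q ^ (i + 1) * (g (2 * i + 2) + g (2 * i + 1)) + g 0
          + q ^ (k + 2) * g (2 * (k + 1) + 1) := by
      simp only [mul_add, Finset.sum_add_distrib]
      rw [Finset.sum_range_succ' (fun i => q ^ i * g (2 * i)), Finset.sum_range_succ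
        (fun i => q ^ i * (q * g (2 * i + 1)))]
      simp only [pow_succ, mul_add, mul_one, pow_zero, one_mul, mul_zero, mul_assoc]
      ring
    have h2 : ∑ i ∈ Finset.range (k + 1), q ^ (i + 1) * (g (2 * i + 2) + g (2 * i + 1)) =
        ∑ i ∈ Finset.range (k + 1), q ^ i * (g (2 * i + 1) + q * g (2 * i + 1 + 1)) +
        ∑ i ∈ Finset.range (k + 1), (q - 1) * q ^ i * g (2 * i + 1) := by
      rw [← Finset.sum_add_distrib]
      refine Finset.sum_congr rfl fun i _ => ?_
      ring_nf
    rw [h1, h2, hd2]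
    ring

theorem card_edgeSet_regularDendrimer_add_two {d : ℕ} (hd : 2 ≤ d) (k : ℕ) :
    (Nat.card (regularDendrimer (k + 2) d).edgeSet : ℚ) =
      Nat.card (regularDendrimer (k + 1) d).edgeSet + d * ((d : ℚ) - 1) ^ (k + 1) := by
  have := finite_regularDendrimerAux d (k + 1)
  have h := card_edgeSet_attachPendants (G := regularDendrimer (k + 1) d) (d - 1)
  change Nat.card (regularDendrimer (k + 2) d).edgeSet = _ at h
  rw [h, Nat.cast_add, Nat.cast_mul, card_degreeOneVertex_regularDendrimer hd,
    Nat.cast_pred (by omega)]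
  ring

theorem edgeEdgeSum_regularDendrimer_add_two {d : ℕ} (hd : 2 ≤ d) (k : ℕ) (g : ℕ → ℚ) :
    edgeEdgeSum (regularDendrimer (k + 2) d) g =
      edgeEdgeSum (regularDendrimer (k + 1) d) g
        + 2 * pendantEdgeSum (regularDendrimer (k + 2) d) g
        - pendantPendantSum (regularDendrimer (k + 2) d) g :=
  have := finite_regularDendrimerAux d (k + 1)
  edgeEdgeSum_attachPendants (lineGraph_regularDendrimer_preconnected d k)
    (by omega : 0 < d - 1) g

/-! ### The closed formulas -/

/-- The linear functional `g ↦ ∑ j, c j * g j`, where `c j` is the coefficient of `x ^ j` in the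
closed formula for the edge-Hosoya polynomial of `T_{k,d}`, with `d.choose 2` written as
`d * (d - 1) / 2`. -/
noncomputable def hosoyaSum (k : ℕ) (d : ℚ) (g : ℕ → ℚ) : ℚ :=
  ∑ i ∈ Finset.range k, (d - 1) ^ (2 * i) * d * (((d - 1) ^ (k - i) - 1) / (d - 2)) * g (2 * i)
    + ∑ i ∈ Finset.range k, (d - 1) ^ (2 * i) * (d * (d - 1) / 2)
        * (d * (((d - 1) ^ (k - i - 1) - 1) / (d - 2)) + 1) * g (2 * i + 1)

/-- The increment counts the pairs that contain an edge of the new outermost level. -/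
theorem hosoyaSum_succ {d : ℚ} (hd : d - 2 ≠ 0) (k : ℕ) (g : ℕ → ℚ) :
    hosoyaSum (k + 1) d g = hosoyaSum k d g + d * (d - 1) ^ k *
      (∑ i ∈ Finset.range k, (d - 1) ^ i * (g (2 * i) + d / 2 * g (2 * i + 1))
        + (d - 1) ^ k * (g (2 * k) + (d - 1) / 2 * g (2 * k + 1))) := by
  have even : ∑ i ∈ Finset.range k,
      (d - 1) ^ (2 * i) * d * (((d - 1) ^ (k + 1 - i) - 1) / (d - 2)) * g (2 * i) =
      ∑ i ∈ Finset.range k,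
        (d - 1) ^ (2 * i) * d * (((d - 1) ^ (k - i) - 1) / (d - 2)) * g (2 * i) +
      d * (d - 1) ^ k * ∑ i ∈ Finset.range k, (d - 1) ^ i * g (2 * i) := by
    rw [Finset.mul_sum, ← Finset.sum_add_distrib]
    refine Finset.sum_congr rfl fun i hi => ?_
    obtain ⟨t, rfl⟩ := Nat.exists_eq_add_of_lt (Finset.mem_range.1 hi)
    rw [show i + t + 1 + 1 - i = t + 2 by omega, show i + t + 1 - i = t + 1 by omega]
    field_simp
    ring
  have odd : ∑ i ∈ Finset.range k, (d - 1) ^ (2 * i) * (d * (d - 1) / 2)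
        * (d * (((d - 1) ^ (k + 1 - i - 1) - 1) / (d - 2)) + 1) * g (2 * i + 1) =
      ∑ i ∈ Finset.range k, (d - 1) ^ (2 * i) * (d * (d - 1) / 2)
        * (d * (((d - 1) ^ (k - i - 1) - 1) / (d - 2)) + 1) * g (2 * i + 1) +
      d * (d - 1) ^ k * ∑ i ∈ Finset.range k, (d - 1) ^ i * (d / 2 * g (2 * i + 1)) := by
    rw [Finset.mul_sum, ← Finset.sum_add_distrib]
    refine Finset.sum_congr rfl fun i hi => ?_
    obtain ⟨t, rfl⟩ := Nat.exists_eq_add_of_lt (Finset.mem_range.1 hi)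
    rw [show i + t + 1 + 1 - i - 1 = t + 1 by omega, show i + t + 1 - i - 1 = t by omega]
    field_simp
    ring
  have split : ∑ i ∈ Finset.range k, (d - 1) ^ i * (g (2 * i) + d / 2 * g (2 * i + 1)) =
      ∑ i ∈ Finset.range k, (d - 1) ^ i * g (2 * i) +
        ∑ i ∈ Finset.range k, (d - 1) ^ i * (d / 2 * g (2 * i + 1)) := by
    simp only [mul_add, Finset.sum_add_distrib]
  simp only [hosoyaSum, Finset.sum_range_succ, even, odd, split]
  rw [show k + 1 - k = 1 by omega, Nat.sub_self, pow_zero, pow_one,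
    show d - 1 - 1 = d - 2 by ring, div_self hd]
  ring

/-- The edge-Hosoya polynomial of `T_{k,d}` in the dual form: all three parts of the main result
are instances of this identity. -/
theorem finsum_edgePairDist_regularDendrimer {d : ℕ} (hd : 3 ≤ d) (k : ℕ) (g : ℕ → ℚ) :
    ∑ᶠ p : Sym2 (regularDendrimer k d).edgeSet, g (edgePairDist (regularDendrimer k d) p) =
      hosoyaSum k d g := by
  have hd2 : (d : ℚ) - 2 ≠ 0 := by
    have : (3 : ℚ) ≤ d := by exact_mod_cast hd
    linarith
  obtain _ | k := k
  · have : IsEmpty (regularDendrimer 0 d).edgeSet :=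
      ⟨fun ⟨e, he⟩ => Sym2.ind (fun _ _ h => h.elim) e he⟩
    rw [finsum_of_isEmpty]
    simp [hosoyaSum]
  have hfin := finite_regularDendrimerAux d
  induction k with
  | zero =>
    have h := two_mul_finsum_edgePairDist (G := SimpleGraph.starGraph (0 : Fin (d + 1))) g
    rw [edgeEdgeSum_starGraph, ← Nat.card_congr (Equiv.ofBijective _ (starGraphEdge_bijective d)),
      Nat.card_fin] at h
    refine (mul_right_injective₀ (two_ne_zero (α := ℚ))) (h.trans ?_)
    have h1 : (d : ℚ) - 1 - 1 = d - 2 := by ring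
    simp [hosoyaSum, h1, hd2]
    ring
  | succ k ih =>
    have h0 := two_mul_finsum_edgePairDist (G := regularDendrimer (k + 1) d) g
    have h1 := two_mul_finsum_edgePairDist (G := regularDendrimer (k + 2) d) g
    rw [edgeEdgeSum_regularDendrimer_add_two (by omega),
      card_edgeSet_regularDendrimer_add_two (by omega),
      pendantEdgeSum_regularDendrimer (by omega),
      pendantPendantSum_regularDendrimer (by omega), Finset.sum_range_succ _ (k + 1)] at h1
    rw [ih] at h0
    rw [hosoyaSum_succ hd2]
    have h2 : ∑ i ∈ Finset.range (k + 1),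
        ((d : ℚ) - 1) ^ i * (g (2 * i) + (d : ℚ) / 2 * g (2 * i + 1)) =
        ∑ i ∈ Finset.range (k + 1),
          ((d : ℚ) - 1) ^ i * (g (2 * i) + ((d : ℚ) - 1) * g (2 * i + 1)) -
        1 / 2 * ∑ i ∈ Finset.range (k + 1),
          ((d : ℚ) - 2) * ((d : ℚ) - 1) ^ i * g (2 * i + 1) := by
      rw [Finset.mul_sum, ← Finset.sum_sub_distrib]
      refine Finset.sum_congr rfl fun i _ => ?_
      ring
    rw [h2]
    linear_combination (1 / 2 : ℚ) * h1 - (1 / 2 : ℚ) * h0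

theorem sum_pow_range {q : ℚ} (hq : q - 1 ≠ 0) (k : ℕ) :
    ∑ i ∈ Finset.range k, q ^ i = (q ^ k - 1) / (q - 1) :=
  geom_sum_eq (sub_ne_zero.1 hq) k

theorem sum_mul_pow_range {q : ℚ} (hq : q - 1 ≠ 0) (k : ℕ) :
    ∑ i ∈ Finset.range k, i * q ^ i = k * q ^ k / (q - 1) - q * (q ^ k - 1) / (q - 1) ^ 2 := by
  induction k with
  | zero => simp
  | succ k ih =>
    rw [Finset.sum_range_succ, ih]
    push_cast
    field_simp
    ring

theorem sum_sq_mul_pow_range {q : ℚ} (hq : q - 1 ≠ 0) (k : ℕ) :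
    ∑ i ∈ Finset.range k, (i : ℚ) ^ 2 * q ^ i = k ^ 2 * q ^ k / (q - 1)
      - 2 * k * q ^ (k + 1) / (q - 1) ^ 2 + q * (q + 1) * (q ^ k - 1) / (q - 1) ^ 3 := by
  induction k with
  | zero => simp
  | succ k ih =>
    rw [Finset.sum_range_succ, ih]
    push_cast
    field_simp
    ring

theorem hosoyaSum_id {d : ℚ} (hd : d - 2 ≠ 0) (k : ℕ) :
    hosoyaSum k d (fun j => j) =
      d * (2 - 2 * d + (d - 1) ^ k * (d ^ 2 + 4 * d - 4)
        + (d - 1) ^ (2 * k) * (2 - d * (d + 2) + 2 * (d - 2) * d * k)) / (2 * (d - 2) ^ 3) := by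
  have hq : d - 1 - 1 ≠ 0 := by rwa [show d - 1 - 1 = d - 2 by ring]
  induction k with
  | zero => simp [hosoyaSum]; field_simp; ring
  | succ k ih =>
    rw [hosoyaSum_succ hd, ih]
    have h : ∑ i ∈ Finset.range k, (d - 1) ^ i *
        (((2 * i : ℕ) : ℚ) + d / 2 * ((2 * i + 1 : ℕ) : ℚ)) =
        (2 + d) * ∑ i ∈ Finset.range k, i * (d - 1) ^ i
          + d / 2 * ∑ i ∈ Finset.range k, (d - 1) ^ i := by
      rw [Finset.mul_sum, Finset.mul_sum, ← Finset.sum_add_distrib]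
      refine Finset.sum_congr rfl fun i _ => ?_
      push_cast
      ring
    rw [h, sum_pow_range hq, sum_mul_pow_range hq, show d - 1 - 1 = d - 2 by ring]
    push_cast
    field_simp
    ring

theorem hosoyaSum_id_add_sq {d : ℚ} (hd : d - 2 ≠ 0) (k : ℕ) :
    1 / 2 * hosoyaSum k d (fun j => j) + 1 / 2 * hosoyaSum k d (fun j => (j : ℚ) ^ 2) =
      d * ((2 * (d - 1) + (d - 1) ^ k * (4 - 5 * d ^ 2)) / (2 * (d - 2) ^ 4))
        + d * (((d - 1) ^ (2 * k) * (-2 - 8 * (k : ℚ)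
          + d * (-2 + 5 * d + 16 * k - d * (d + 4) * k + 2 * (d - 2) ^ 2 * (k : ℚ) ^ 2)))
            / (2 * (d - 2) ^ 4)) := by
  have hq : d - 1 - 1 ≠ 0 := by rwa [show d - 1 - 1 = d - 2 by ring]
  induction k with
  | zero => simp [hosoyaSum]; field_simp; ring
  | succ k ih =>
    rw [hosoyaSum_succ hd, hosoyaSum_succ hd k (fun j => (j : ℚ) ^ 2)]
    have h : ∑ i ∈ Finset.range k, (d - 1) ^ i *
        (((2 * i : ℕ) : ℚ) + d / 2 * ((2 * i + 1 : ℕ) : ℚ)) =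
        (2 + d) * ∑ i ∈ Finset.range k, i * (d - 1) ^ i
          + d / 2 * ∑ i ∈ Finset.range k, (d - 1) ^ i := by
      rw [Finset.mul_sum, Finset.mul_sum, ← Finset.sum_add_distrib]
      refine Finset.sum_congr rfl fun i _ => ?_
      push_cast
      ring
    have h' : ∑ i ∈ Finset.range k, (d - 1) ^ i *
        (((2 * i : ℕ) : ℚ) ^ 2 + d / 2 * ((2 * i + 1 : ℕ) : ℚ) ^ 2) =
        (4 + 2 * d) * ∑ i ∈ Finset.range k, (i : ℚ) ^ 2 * (d - 1) ^ i
          + 2 * d * ∑ i ∈ Finset.range k, i * (d - 1) ^ i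
          + d / 2 * ∑ i ∈ Finset.range k, (d - 1) ^ i := by
      rw [Finset.mul_sum, Finset.mul_sum, Finset.mul_sum, ← Finset.sum_add_distrib,
        ← Finset.sum_add_distrib]
      refine Finset.sum_congr rfl fun i _ => ?_
      push_cast
      ring
    rw [h, h', sum_pow_range hq, sum_mul_pow_range hq, sum_sq_mul_pow_range hq,
      show d - 1 - 1 = d - 2 by ring]
    rw [← sub_eq_zero] at ih ⊢
    rw [← ih]
    push_cast
    field_simp
    ring

end Dendrimer

theorem mainTheorem4 (k d : ℕ) (hd : 3 ≤ d) :
    edgeHosoya (regularDendrimer k d) =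
        (∑ i ∈ Finset.range k,
            C (((d : ℚ) - 1) ^ (2 * i) * d * ((((d : ℚ) - 1) ^ (k - i) - 1) / ((d : ℚ) - 2)))
              * X ^ (2 * i))
          + ∑ i ∈ Finset.range k,
            C (((d : ℚ) - 1) ^ (2 * i) * (d.choose 2 : ℚ)
                * (d * ((((d : ℚ) - 1) ^ (k - i - 1) - 1) / ((d : ℚ) - 2)) + 1))
              * X ^ (2 * i + 1) ∧
    edgeWiener (regularDendrimer k d) =
        (d : ℚ) * (2 - 2 * d + ((d : ℚ) - 1) ^ k * ((d : ℚ) ^ 2 + 4 * d - 4)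
            + ((d : ℚ) - 1) ^ (2 * k)
              * (2 - (d : ℚ) * (d + 2) + 2 * ((d : ℚ) - 2) * d * k))
          / (2 * ((d : ℚ) - 2) ^ 3) ∧
    edgeHyperWiener (regularDendrimer k d) =
        (d : ℚ) * ((2 * ((d : ℚ) - 1) + ((d : ℚ) - 1) ^ k * (4 - 5 * (d : ℚ) ^ 2))
            / (2 * ((d : ℚ) - 2) ^ 4))
          + (d : ℚ) * ((((d : ℚ) - 1) ^ (2 * k)
              * (-2 - 8 * (k : ℚ)
                + (d : ℚ) * (-2 + 5 * (d : ℚ) + 16 * k - (d : ℚ) * (d + 4) * k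
                  + 2 * ((d : ℚ) - 2) ^ 2 * (k : ℚ) ^ 2)))
            / (2 * ((d : ℚ) - 2) ^ 4)) := by
  have hd2 : (d : ℚ) - 2 ≠ 0 := by
    have : (3 : ℚ) ≤ d := by exact_mod_cast hd
    linarith
  have := finite_regularDendrimerAux d k
  refine ⟨?_, ?_, ?_⟩
  · ext n
    -- The coefficient of `X ^ n` is the sum for the indicator function of `{n}`.
    rw [coeff_edgeHosoya, finsum_edgePairDist_regularDendrimer hd k
      (fun j => if n = j then 1 else 0), hosoyaSum]
    simp only [coeff_add, finsetSum_coeff, coeff_C_mul, coeff_X_pow, Nat.cast_choose_two]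
  · rw [edgeWiener, finsum_edgePairDist_regularDendrimer hd k (fun j => (j : ℚ)),
      hosoyaSum_id hd2]
  · rw [edgeHyperWiener, finsum_edgePairDist_regularDendrimer hd k (fun j => (j : ℚ)),
      finsum_edgePairDist_regularDendrimer hd k (fun j => (j : ℚ) ^ 2), hosoyaSum_id_add_sq hd2]
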